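/- Rings are associative and not necessarily unital. A ring $R \neq 0$ with center $Z(R)$ is prime if $aRb=0$ implies $a=0$ or $b=0$ for all $a,b\in R$. For subsets $A,B$ of a ring, $AB$ denotes the additive subgroup generated by all products $ab$ with $a\in A$, $b\in B$. A Lie ideal of $R$ is an additive subgroup $L$ with $xr-rx\in L$ for all $x\in L$, $r\in R$; it is noncentral if $L\not\subseteq Z(R)$. For a prime ring $R$ let $Q_s(R)\supseteq R$ be its symmetric Martindale ring of quotients, and let the extended centroid $C$ be the center of $Q_s(R)$. \textbf{Proposition.} Let $R$ be a prime ring with noncentral Lie ideals $K$ and $L$. Then $KL$ contains a nonzero (two-sided) ideal of $R$, except precisely when $KC=LC=Ca+C$ for some $a\in L$; that is, $KL$ contains a nonzero ideal of $R$ if and only if there is no $a\in L$ with $KC=LC=Ca+C$ (an equality of additive subgroups of $Q_s(R)$). -/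

import Mathlib

/-- A (not necessarily unital) ring is prime if `aRb = 0` implies `a = 0` or `b = 0`. -/
class IsPrimeRing (R : Type*) [NonUnitalRing R] : Prop where
  eq_zero_or_eq_zero : ∀ a b : R, (∀ r : R, a * r * b = 0) → a = 0 ∨ b = 0

/-- A Lie ideal is an additive subgroup `L` with `[L, R] ⊆ L`. -/
def IsLieIdeal {R : Type*} [NonUnitalRing R] (L : AddSubgroup R) : Prop :=
  ∀ x ∈ L, ∀ r : R, x * r - r * x ∈ L

/-- The product `AB` of two subsets: the additive subgroup generated by all `a * b`,
`a ∈ A`, `b ∈ B`. -/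
def addProd {S : Type*} [NonUnitalRing S] (A B : Set S) : AddSubgroup S :=
  AddSubgroup.closure (Set.image2 (fun a b => a * b) A B)

/-- The additive subgroup `A` contains a nonzero (two-sided) ideal of `R`. -/
def ContainsNonzeroIdeal {R : Type*} [NonUnitalRing R] (A : AddSubgroup R) : Prop :=
  ∃ I : TwoSidedIdeal R, I ≠ ⊥ ∧ (I : Set R) ⊆ (A : Set R)

namespace Martindale

section NonzeroIdeals

variable {R : Type*} [NonUnitalRing R]

theorem exists_ne_zero {I : TwoSidedIdeal R} (h : I ≠ ⊥) : ∃ x ∈ I, x ≠ 0 := by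
  by_contra! hc
  refine h (TwoSidedIdeal.ext fun x => ?_)
  rw [TwoSidedIdeal.mem_bot]
  exact ⟨hc x, fun hx => hx ▸ I.zero_mem⟩

theorem ne_bot_of_mem {I : TwoSidedIdeal R} {x : R} (hx : x ∈ I) (h : x ≠ 0) : I ≠ ⊥ := by
  rintro rfl
  exact h ((TwoSidedIdeal.mem_bot R).1 hx)

theorem exists_mul_ne_zero [IsPrimeRing R] {I J : TwoSidedIdeal R} (hI : I ≠ ⊥) (hJ : J ≠ ⊥) :
    ∃ x ∈ I, ∃ y ∈ J, x * y ≠ 0 := by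
  obtain ⟨a, ha, ha0⟩ := exists_ne_zero hI
  obtain ⟨b, hb, hb0⟩ := exists_ne_zero hJ
  by_contra! hc
  exact (IsPrimeRing.eq_zero_or_eq_zero a b fun r =>
    hc _ (I.mul_mem_right _ _ ha) _ hb).elim ha0 hb0

theorem inf_ne_bot [IsPrimeRing R] {I J : TwoSidedIdeal R} (hI : I ≠ ⊥) (hJ : J ≠ ⊥) :
    I ⊓ J ≠ ⊥ := by
  obtain ⟨x, hx, y, hy, h⟩ := exists_mul_ne_zero hI hJ
  exact ne_bot_of_mem
    ((TwoSidedIdeal.mem_inf R).2 ⟨I.mul_mem_right _ _ hx, J.mul_mem_left _ _ hy⟩) h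

theorem top_ne_bot [Nontrivial R] : (⊤ : TwoSidedIdeal R) ≠ ⊥ := by
  obtain ⟨x, hx⟩ := exists_ne (0 : R)
  exact ne_bot_of_mem (TwoSidedIdeal.mem_top R) hx

end NonzeroIdeals

/-- A homomorphism of right `R`-modules `f : J → R` defined on a nonzero two-sided ideal `J`
of `R`. It is represented by a total function, of which only the values on `J` matter. -/
structure PartialHom (R : Type*) [NonUnitalRing R] where
  dom : TwoSidedIdeal R
  dom_ne_bot : dom ≠ ⊥
  toFun : R → R
  map_add' : ∀ x ∈ dom, ∀ y ∈ dom, toFun (x + y) = toFun x + toFun y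
  map_mul' : ∀ x ∈ dom, ∀ r : R, toFun (x * r) = toFun x * r

namespace PartialHom

section Basic

variable {R : Type*} [NonUnitalRing R]

theorem map_zero' (f : PartialHom R) : f.toFun 0 = 0 := by
  have h := f.map_mul' 0 f.dom.zero_mem 0
  simpa using h

theorem map_neg' (f : PartialHom R) {x : R} (hx : x ∈ f.dom) : f.toFun (-x) = -f.toFun x := by
  have h := f.map_add' x hx (-x) (f.dom.neg_mem hx)
  rw [add_neg_cancel, f.map_zero'] at h
  exact (neg_eq_of_add_eq_zero_right h.symm).symm

/-- The largest two-sided ideal inside `{x ∈ dom f | f x ∈ I}`. -/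
def pull (f : PartialHom R) (I : TwoSidedIdeal R) : TwoSidedIdeal R :=
  TwoSidedIdeal.mk' {x | x ∈ f.dom ∧ f.toFun x ∈ I ∧ ∀ r : R, f.toFun (r * x) ∈ I}
    ⟨f.dom.zero_mem, by rw [f.map_zero']; exact I.zero_mem,
      fun r => by rw [mul_zero, f.map_zero']; exact I.zero_mem⟩
    (by
      rintro x y ⟨hx, hx1, hx2⟩ ⟨hy, hy1, hy2⟩
      refine ⟨f.dom.add_mem hx hy, ?_, fun r => ?_⟩
      · rw [f.map_add' x hx y hy]
        exact I.add_mem hx1 hy1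
      · rw [mul_add, f.map_add' _ (f.dom.mul_mem_left _ _ hx) _ (f.dom.mul_mem_left _ _ hy)]
        exact I.add_mem (hx2 r) (hy2 r))
    (by
      rintro x ⟨hx, hx1, hx2⟩
      refine ⟨f.dom.neg_mem hx, ?_, fun r => ?_⟩
      · rw [f.map_neg' hx]
        exact I.neg_mem hx1
      · rw [mul_neg, f.map_neg' (f.dom.mul_mem_left _ _ hx)]
        exact I.neg_mem (hx2 r))
    (by
      rintro x y ⟨hy, hy1, hy2⟩
      exact ⟨f.dom.mul_mem_left _ _ hy, hy2 x, fun r => by rw [← mul_assoc]; exact hy2 _⟩)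
    (by
      rintro x y ⟨hx, hx1, hx2⟩
      refine ⟨f.dom.mul_mem_right _ _ hx, ?_, fun r => ?_⟩
      · rw [f.map_mul' x hx]
        exact I.mul_mem_right _ _ hx1
      · rw [← mul_assoc, f.map_mul' _ (f.dom.mul_mem_left _ _ hx)]
        exact I.mul_mem_right _ _ (hx2 r))

theorem mem_pull {f : PartialHom R} {I : TwoSidedIdeal R} {x : R} :
    x ∈ f.pull I ↔ x ∈ f.dom ∧ f.toFun x ∈ I ∧ ∀ r : R, f.toFun (r * x) ∈ I :=
  TwoSidedIdeal.mem_mk' _ _ _ _ _ _ x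

theorem pull_ne_bot [IsPrimeRing R] (f : PartialHom R) {I : TwoSidedIdeal R} (hI : I ≠ ⊥) :
    f.pull I ≠ ⊥ := by
  obtain ⟨x, hx, y, hy, h⟩ := exists_mul_ne_zero f.dom_ne_bot hI
  refine ne_bot_of_mem (mem_pull.2 ⟨f.dom.mul_mem_right _ _ hx, ?_, fun r => ?_⟩) h
  · rw [f.map_mul' x hx]
    exact I.mul_mem_left _ _ hy
  · rw [← mul_assoc, f.map_mul' _ (f.dom.mul_mem_left _ _ hx)]
    exact I.mul_mem_left _ _ hy

/-- Left multiplication by `a`, defined on all of `R`. -/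
def ofElem [Nontrivial R] (a : R) : PartialHom R where
  dom := ⊤
  dom_ne_bot := top_ne_bot
  toFun x := a * x
  map_add' x _ y _ := mul_add a x y
  map_mul' x _ r := (mul_assoc a x r).symm

/-- The identity map of `R`. -/
def one [Nontrivial R] : PartialHom R where
  dom := ⊤
  dom_ne_bot := top_ne_bot
  toFun x := x
  map_add' _ _ _ _ := rfl
  map_mul' _ _ _ := rfl

/-- The zero map of `R`. -/
def zero [Nontrivial R] : PartialHom R where
  dom := ⊤
  dom_ne_bot := top_ne_bot
  toFun _ := 0
  map_add' _ _ _ _ := (add_zero 0).symm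
  map_mul' _ _ r := (zero_mul r).symm

/-- The pointwise negative. -/
def neg (f : PartialHom R) : PartialHom R where
  dom := f.dom
  dom_ne_bot := f.dom_ne_bot
  toFun x := -f.toFun x
  map_add' x hx y hy := by rw [f.map_add' x hx y hy, neg_add]
  map_mul' x hx r := by rw [f.map_mul' x hx r, neg_mul]

variable [IsPrimeRing R]

/-- The pointwise sum, defined on the intersection of the domains. -/
def add (f g : PartialHom R) : PartialHom R where
  dom := f.dom ⊓ g.dom
  dom_ne_bot := inf_ne_bot f.dom_ne_bot g.dom_ne_bot
  toFun x := f.toFun x + g.toFun x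
  map_add' x hx y hy := by
    rw [TwoSidedIdeal.mem_inf] at hx hy
    rw [f.map_add' x hx.1 y hy.1, g.map_add' x hx.2 y hy.2]
    exact add_add_add_comm _ _ _ _
  map_mul' x hx r := by
    rw [TwoSidedIdeal.mem_inf] at hx
    rw [f.map_mul' x hx.1, g.map_mul' x hx.2, add_mul]

/-- The composition `f ∘ g`. -/
def mul (f g : PartialHom R) : PartialHom R where
  dom := g.pull f.dom
  dom_ne_bot := g.pull_ne_bot f.dom_ne_bot
  toFun x := f.toFun (g.toFun x)
  map_add' x hx y hy := by
    rw [mem_pull] at hx hy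
    rw [g.map_add' x hx.1 y hy.1, f.map_add' _ hx.2.1 _ hy.2.1]
  map_mul' x hx r := by
    rw [mem_pull] at hx
    rw [g.map_mul' x hx.1, f.map_mul' _ hx.2.1]

/-- Two partial homomorphisms are identified if they agree on a nonzero ideal contained in
both domains. -/
instance setoid (R : Type*) [NonUnitalRing R] [IsPrimeRing R] : Setoid (PartialHom R) where
  r f g := ∃ I : TwoSidedIdeal R, I ≠ ⊥ ∧ I ≤ f.dom ∧ I ≤ g.dom ∧ ∀ x ∈ I, f.toFun x = g.toFun x
  iseqv :=
    { refl := fun f => ⟨f.dom, f.dom_ne_bot, le_rfl, le_rfl, fun _ _ => rfl⟩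
      symm := fun ⟨I, h, h1, h2, h3⟩ => ⟨I, h, h2, h1, fun x hx => (h3 x hx).symm⟩
      trans := fun ⟨I, h, h1, _, h3⟩ ⟨J, k, _, k2, k3⟩ =>
        ⟨I ⊓ J, inf_ne_bot h k, inf_le_left.trans h1, inf_le_right.trans k2, fun x hx =>
          (h3 x ((TwoSidedIdeal.mem_inf R).1 hx).1).trans (k3 x ((TwoSidedIdeal.mem_inf R).1 hx).2)⟩ }

theorem equiv_iff {f g : PartialHom R} : f ≈ g ↔ ∃ I : TwoSidedIdeal R,
    I ≠ ⊥ ∧ I ≤ f.dom ∧ I ≤ g.dom ∧ ∀ x ∈ I, f.toFun x = g.toFun x :=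
  Iff.rfl

theorem equiv_of_agree {f g : PartialHom R} {I : TwoSidedIdeal R} (hI : I ≠ ⊥)
    (h : ∀ x ∈ I, x ∈ f.dom → x ∈ g.dom → f.toFun x = g.toFun x) : f ≈ g := by
  refine ⟨I ⊓ (f.dom ⊓ g.dom), inf_ne_bot hI (inf_ne_bot f.dom_ne_bot g.dom_ne_bot),
    inf_le_right.trans inf_le_left, inf_le_right.trans inf_le_right, fun x hx => ?_⟩
  simp only [TwoSidedIdeal.mem_inf] at hx
  exact h x hx.1 hx.2.1 hx.2.2

theorem equiv_of_agree_dom {f g : PartialHom R}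
    (h : ∀ x, x ∈ f.dom → x ∈ g.dom → f.toFun x = g.toFun x) : f ≈ g :=
  equiv_of_agree f.dom_ne_bot fun x _ => h x

end Basic

end PartialHom

section RightQuotients

variable (R : Type*) [NonUnitalRing R] [IsPrimeRing R]

/-- The right Martindale ring of quotients of a prime ring `R`: partial right module
homomorphisms on nonzero ideals, up to agreement on a nonzero ideal, with pointwise addition
and with composition as the product. -/
def RightQuotient : Type _ := Quotient (PartialHom.setoid R)

variable {R}

namespace RightQuotient

open PartialHom

/-- The class of a partial homomorphism. -/
def mk (f : PartialHom R) : RightQuotient R := Quotient.mk _ f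

theorem mk_eq_mk {f g : PartialHom R} : mk f = mk g ↔ f ≈ g := Quotient.eq

theorem ind {p : RightQuotient R → Prop} (h : ∀ f, p (mk f)) (q : RightQuotient R) : p q :=
  Quotient.inductionOn q h

instance : Add (RightQuotient R) where
  add := Quotient.map₂ PartialHom.add (by
    rintro f f' ⟨I, hI, _, _, hf⟩ g g' ⟨J, hJ, _, _, hg⟩
    refine equiv_of_agree (inf_ne_bot hI hJ) fun x hx _ _ => ?_
    rw [TwoSidedIdeal.mem_inf] at hx
    exact congrArg₂ (· + ·) (hf x hx.1) (hg x hx.2))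

instance : Mul (RightQuotient R) where
  mul := Quotient.map₂ PartialHom.mul (by
    rintro f f' ⟨I, hI, _, _, hf⟩ g g' ⟨J, hJ, _, _, hg⟩
    refine equiv_of_agree (inf_ne_bot hJ (g.pull_ne_bot hI)) fun x hx _ _ => ?_
    rw [TwoSidedIdeal.mem_inf, mem_pull] at hx
    exact (hf _ hx.2.2.1).trans (congrArg f'.toFun (hg x hx.1)))

instance : Neg (RightQuotient R) where
  neg := Quotient.map PartialHom.neg (by
    rintro f f' ⟨I, hI, _, _, hf⟩
    exact equiv_of_agree hI fun x hx _ _ => congrArg (- ·) (hf x hx))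

theorem mk_add (f g : PartialHom R) : mk f + mk g = mk (f.add g) := rfl

theorem mk_mul (f g : PartialHom R) : mk f * mk g = mk (f.mul g) := rfl

theorem mk_neg (f : PartialHom R) : -mk f = mk f.neg := rfl

variable [Nontrivial R]

instance : Zero (RightQuotient R) where
  zero := mk PartialHom.zero

instance : One (RightQuotient R) where
  one := mk PartialHom.one

theorem zero_def : (0 : RightQuotient R) = mk PartialHom.zero := rfl

theorem one_def : (1 : RightQuotient R) = mk PartialHom.one := rfl

instance : Ring (RightQuotient R) where
  add_assoc := by
    refine ind fun f => ind fun g => ind fun h => ?_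
    exact mk_eq_mk.2 (equiv_of_agree_dom fun x _ _ => add_assoc _ _ _)
  zero_add := by
    refine ind fun f => ?_
    exact mk_eq_mk.2 (equiv_of_agree_dom fun x _ _ => zero_add _)
  add_zero := by
    refine ind fun f => ?_
    exact mk_eq_mk.2 (equiv_of_agree_dom fun x _ _ => add_zero _)
  add_comm := by
    refine ind fun f => ind fun g => ?_
    exact mk_eq_mk.2 (equiv_of_agree_dom fun x _ _ => add_comm _ _)
  neg_add_cancel := by
    refine ind fun f => ?_
    exact mk_eq_mk.2 (equiv_of_agree_dom fun x _ _ => neg_add_cancel _)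
  mul_assoc := by
    refine ind fun f => ind fun g => ind fun h => ?_
    exact mk_eq_mk.2 (equiv_of_agree_dom fun x _ _ => rfl)
  one_mul := by
    refine ind fun f => ?_
    exact mk_eq_mk.2 (equiv_of_agree_dom fun x _ _ => rfl)
  mul_one := by
    refine ind fun f => ?_
    exact mk_eq_mk.2 (equiv_of_agree_dom fun x _ _ => rfl)
  zero_mul := by
    refine ind fun f => ?_
    exact mk_eq_mk.2 (equiv_of_agree_dom fun x _ _ => rfl)
  mul_zero := by
    refine ind fun f => ?_
    exact mk_eq_mk.2 (equiv_of_agree_dom fun x _ _ => f.map_zero')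
  left_distrib := by
    refine ind fun f => ind fun g => ind fun h => ?_
    refine mk_eq_mk.2 (equiv_of_agree_dom fun x _ hx => ?_)
    obtain ⟨h1, h2⟩ := (TwoSidedIdeal.mem_inf R).1 hx
    exact f.map_add' _ (mem_pull.1 h1).2.1 _ (mem_pull.1 h2).2.1
  right_distrib := by
    refine ind fun f => ind fun g => ind fun h => ?_
    exact mk_eq_mk.2 (equiv_of_agree_dom fun x _ _ => rfl)
  nsmul := nsmulRec
  zsmul := zsmulRec

/-- The canonical map `R → Q_r(R)`, sending `a` to left multiplication by `a`. -/
def ofRing : R →ₙ+* RightQuotient R where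
  toFun a := mk (PartialHom.ofElem a)
  map_mul' a b := mk_eq_mk.2 (equiv_of_agree_dom fun x _ _ => mul_assoc a b x)
  map_zero' := mk_eq_mk.2 (equiv_of_agree_dom fun x _ _ => zero_mul x)
  map_add' a b := mk_eq_mk.2 (equiv_of_agree_dom fun x _ _ => add_mul a b x)

theorem ofRing_injective : Function.Injective (ofRing (R := R)) := by
  refine (injective_iff_map_eq_zero _).2 fun a ha => ?_
  obtain ⟨I, hI, _, _, h⟩ := mk_eq_mk.1 ha
  obtain ⟨b, hb, hb0⟩ := exists_ne_zero hI
  refine (IsPrimeRing.eq_zero_or_eq_zero a b fun r => ?_).resolve_right hb0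
  rw [mul_assoc]
  exact h (r * b) (I.mul_mem_left _ _ hb)

end RightQuotient

end RightQuotients

section SymmetricQuotients

variable (R : Type*) [NonUnitalRing R] [IsPrimeRing R] [Nontrivial R]

open RightQuotient

/-- The symmetric Martindale ring of quotients, as the subring
`{q | Jq ⊆ R for some nonzero ideal J of R}` of the right Martindale ring of quotients. -/
def symmetricQuotient : Subring (RightQuotient R) where
  carrier := {q | ∃ J : TwoSidedIdeal R, J ≠ ⊥ ∧ ∀ x ∈ J, ∃ y : R, ofRing x * q = ofRing y}
  zero_mem' := ⟨⊤, top_ne_bot, fun x _ => ⟨0, by rw [mul_zero, map_zero]⟩⟩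
  one_mem' := ⟨⊤, top_ne_bot, fun x _ => ⟨x, mul_one _⟩⟩
  add_mem' := by
    rintro p q ⟨I, hI, hp⟩ ⟨J, hJ, hq⟩
    refine ⟨I ⊓ J, inf_ne_bot hI hJ, fun x hx => ?_⟩
    rw [TwoSidedIdeal.mem_inf] at hx
    obtain ⟨y, hy⟩ := hp x hx.1
    obtain ⟨z, hz⟩ := hq x hx.2
    exact ⟨y + z, by rw [mul_add, hy, hz, map_add]⟩
  neg_mem' := by
    rintro p ⟨I, hI, hp⟩
    refine ⟨I, hI, fun x hx => ?_⟩
    obtain ⟨y, hy⟩ := hp x hx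
    exact ⟨-y, by rw [mul_neg, hy, map_neg]⟩
  mul_mem' := by
    rintro p q ⟨I, hI, hp⟩ ⟨J, hJ, hq⟩
    obtain ⟨a, ha, b, hb, hab⟩ := exists_mul_ne_zero hJ hI
    refine ⟨TwoSidedIdeal.mk' {x | (∃ y ∈ J, ofRing x * p = ofRing y) ∧
        ∀ r : R, ∃ y ∈ J, ofRing (x * r) * p = ofRing y} ?_ ?_ ?_ ?_ ?_, ?_, ?_⟩
    · exact ⟨⟨0, J.zero_mem, by rw [map_zero, zero_mul]⟩,
        fun r => ⟨0, J.zero_mem, by rw [zero_mul, map_zero, zero_mul]⟩⟩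
    · rintro x y ⟨⟨u, hu, hxu⟩, hx⟩ ⟨⟨v, hv, hyv⟩, hy⟩
      refine ⟨⟨u + v, J.add_mem hu hv, by rw [map_add, add_mul, hxu, hyv, map_add]⟩, fun r => ?_⟩
      obtain ⟨s, hs, hs'⟩ := hx r
      obtain ⟨t, ht, ht'⟩ := hy r
      exact ⟨s + t, J.add_mem hs ht, by rw [add_mul, map_add, add_mul, hs', ht', map_add]⟩
    · rintro x ⟨⟨u, hu, hxu⟩, hx⟩
      refine ⟨⟨-u, J.neg_mem hu, by rw [map_neg, neg_mul, hxu, map_neg]⟩, fun r => ?_⟩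
      obtain ⟨s, hs, hs'⟩ := hx r
      exact ⟨-s, J.neg_mem hs, by rw [neg_mul, map_neg, neg_mul, hs', map_neg]⟩
    · rintro x y ⟨⟨u, hu, hyu⟩, hy⟩
      refine ⟨⟨x * u, J.mul_mem_left _ _ hu, by rw [map_mul, mul_assoc, hyu, map_mul]⟩,
        fun r => ?_⟩
      obtain ⟨s, hs, hs'⟩ := hy r
      exact ⟨x * s, J.mul_mem_left _ _ hs, by rw [mul_assoc, map_mul, mul_assoc, hs', map_mul]⟩
    · rintro x y ⟨-, hx⟩
      exact ⟨hx y, fun r => by rw [mul_assoc]; exact hx _⟩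
    · refine ne_bot_of_mem (x := a * b) ((TwoSidedIdeal.mem_mk' _ _ _ _ _ _ _).2
        ⟨?_, fun r => ?_⟩) hab
      · obtain ⟨y, hy⟩ := hp b hb
        exact ⟨a * y, J.mul_mem_right _ _ ha, by rw [map_mul, mul_assoc, hy, map_mul]⟩
      · obtain ⟨y, hy⟩ := hp (b * r) (I.mul_mem_right _ _ hb)
        exact ⟨a * y, J.mul_mem_right _ _ ha,
          by rw [mul_assoc, map_mul, mul_assoc, hy, map_mul]⟩
    · intro x hx
      obtain ⟨⟨y, hy, hxy⟩, -⟩ := (TwoSidedIdeal.mem_mk' _ _ _ _ _ _ _).1 hx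
      obtain ⟨z, hz⟩ := hq y hy
      exact ⟨z, by rw [← mul_assoc, hxy, hz]⟩

/-- The symmetric Martindale ring of quotients `Q_s(R)`, as a type. -/
abbrev Qs : Type _ := symmetricQuotient R

/-- The canonical embedding `R → Q_s(R)`. -/
def toQs : R →ₙ+* Qs R where
  toFun a := ⟨ofRing a, ⊤, top_ne_bot, fun x _ => ⟨x * a, (map_mul ofRing x a).symm⟩⟩
  map_mul' a b := Subtype.ext (map_mul ofRing a b)
  map_zero' := Subtype.ext (map_zero ofRing)
  map_add' a b := Subtype.ext (map_add ofRing a b)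

theorem toQs_injective : Function.Injective (toQs R) := fun _ _ h =>
  ofRing_injective (congrArg Subtype.val h)

/-- The extended centroid `C` of `R`: the center of `Q_s(R)`. -/
def extendedCentroid : Subring (Qs R) := Subring.center (Qs R)

variable {R}

/-- `AC`: the additive subgroup of `Q_s(R)` generated by all `a * c`, `a ∈ A`, `c ∈ C`. -/
def centroidSpan (A : Set R) : AddSubgroup (Qs R) :=
  addProd (toQs R '' A) (extendedCentroid R : Set (Qs R))

/-- `Ca + C`, an additive subgroup of `Q_s(R)`. -/
def centroidLine (a : R) : AddSubgroup (Qs R) :=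
  addProd (extendedCentroid R : Set (Qs R)) {toQs R a} ⊔ (extendedCentroid R).toAddSubgroup

end SymmetricQuotients

end Martindale

/-!
If `KL` contains no nonzero ideal of `R`, then, being a Lie ideal, it contains no `Rx` and no `xR`
with `x ≠ 0`. Expanding `[k, rl]l' - [k, rl']l` and `k[l, k'r] - k'[l, kr]` by the Leibniz rule
therefore gives the identities `[k, l]l' = [k, l']l` and `k[l, k'] = k'[l, k]`. Substituting
`l' = [l, x]` and `k' = [k, x]` turns these into generalized polynomial identities that are linear
in `x ∈ R`. By Martindale's theorem such an identity `∑ aᵢ x bᵢ = 0` forces `∑ aᵢ ⊗ bᵢ = 0` in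
`Q_s(R) ⊗ Q_s(R)` over the field `C`, and contracting this tensor with linear functionals shows
that `kl = 0` whenever `1, k, l` are linearly independent. As `kRl ≠ 0` for nonzero `k` and `l`,
this leaves only `K ⊆ Cl + C` for every noncentral `l ∈ L`, and the exceptional case follows.
Conversely, in the exceptional case `KL` commutes with the noncentral element `a`, whereas the
centralizer of a nonzero ideal in a prime ring `R` is the center of `R`.
-/

theorem mul_mem_addProd {S : Type*} [NonUnitalRing S] {A B : Set S} {a b : S} (ha : a ∈ A)
    (hb : b ∈ B) : a * b ∈ addProd A B :=
  AddSubgroup.subset_closure ⟨a, ha, b, hb, rfl⟩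

theorem addProd_le {S : Type*} [NonUnitalRing S] {A B : Set S} {M : AddSubgroup S} :
    addProd A B ≤ M ↔ ∀ a ∈ A, ∀ b ∈ B, a * b ∈ M :=
  (AddSubgroup.closure_le M).trans Set.image2_subset_iff

theorem addProd_le_centralizer {S : Type*} [NonUnitalRing S] {A B : Set S} {s : S}
    (hA : ∀ a ∈ A, a * s = s * a) (hB : ∀ b ∈ B, b * s = s * b) :
    addProd A B ≤ (NonUnitalSubring.centralizer {s}).toAddSubgroup := by
  have hmem {x : S} (hx : x * s = s * x) : x ∈ NonUnitalSubring.centralizer {s} :=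
    NonUnitalSubring.mem_centralizer_iff.2 fun _ hs => hs ▸ hx.symm
  exact addProd_le.2 fun a ha b hb =>
    (NonUnitalSubring.centralizer {s}).mul_mem (hmem (hA a ha)) (hmem (hB b hb))

namespace IsPrimeRing

variable {R : Type*} [NonUnitalRing R] [IsPrimeRing R]

theorem exists_mul_mul_ne_zero {a b : R} (ha : a ≠ 0) (hb : b ≠ 0) : ∃ r, a * r * b ≠ 0 := by
  by_contra! h
  exact (eq_zero_or_eq_zero a b h).elim ha hb

theorem exists_mem_mul_mul_ne_zero {I : TwoSidedIdeal R} (hI : I ≠ ⊥) {a b : R} (ha : a ≠ 0)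
    (hb : b ≠ 0) : ∃ x ∈ I, a * x * b ≠ 0 := by
  obtain ⟨x, hx, hx0⟩ := Martindale.exists_ne_zero hI
  obtain ⟨r, hr⟩ := exists_mul_mul_ne_zero ha hx0
  obtain ⟨s, hs⟩ := exists_mul_mul_ne_zero hr hb
  exact ⟨r * x * s, I.mul_mem_right _ _ (I.mul_mem_left _ _ hx), by simpa only [mul_assoc] using hs⟩

theorem exists_left_right_mul_ne_zero {x : R} (hx : x ≠ 0) : ∃ r s, r * x * s ≠ 0 := by
  obtain ⟨r, hr⟩ := exists_mul_mul_ne_zero hx hx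
  obtain ⟨s, hs⟩ := exists_mul_mul_ne_zero hr hx
  exact ⟨x * r, s * x, by simpa only [mul_assoc] using hs⟩

theorem mem_center_of_commute_ideal {I : TwoSidedIdeal R} (hI : I ≠ ⊥) {a : R}
    (h : ∀ x ∈ I, x * a = a * x) : a ∈ Set.center R := by
  refine Semigroup.mem_center_iff.2 fun r => ?_
  by_contra hne
  obtain ⟨x, hx, hx0⟩ := Martindale.exists_ne_zero hI
  obtain ⟨s, hs⟩ := exists_mul_mul_ne_zero hx0 (sub_ne_zero.2 hne)
  have hxs : x * s ∈ I := I.mul_mem_right _ _ hx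
  refine hs ?_
  rw [mul_sub, ← mul_assoc, ← mul_assoc, h _ (I.mul_mem_right _ _ hxs), h _ hxs, mul_assoc a,
    sub_self]

theorem containsNonzeroIdeal_of_mul_mul_mem {M : AddSubgroup R} {x : R} (hx : x ≠ 0)
    (h : ∀ r s, r * x * s ∈ M) : ContainsNonzeroIdeal M := by
  obtain ⟨r, s, hrs⟩ := exists_left_right_mul_ne_zero hx
  refine ⟨TwoSidedIdeal.span {r * x * s},
    Martindale.ne_bot_of_mem (TwoSidedIdeal.subset_span rfl) hrs, fun z hz => ?_⟩
  refine (AddSubgroup.closure_le M).2 ?_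
    (TwoSidedIdeal.mem_span_iff_mem_addSubgroup_closure_nonunital.1 hz)
  rintro _ (((rfl | ⟨_, rfl, v, -, rfl⟩) | ⟨u, -, _, rfl, rfl⟩) |
    ⟨_, ⟨u, -, _, rfl, rfl⟩, v, -, rfl⟩)
  · exact h r s
  · simpa only [SetLike.mem_coe, mul_assoc] using h r (s * v)
  · simpa only [SetLike.mem_coe, mul_assoc] using h (u * r) s
  · simpa only [SetLike.mem_coe, mul_assoc] using h (u * r) (s * v)

end IsPrimeRing

theorem exists_commutator_ne_zero {R : Type*} [NonUnitalRing R] {a : R} (ha : a ∉ Set.center R) :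
    ∃ r, a * r - r * a ≠ 0 := by
  by_contra! h
  exact ha (Semigroup.mem_center_iff.2 fun r => (sub_eq_zero.1 (h r)).symm)

namespace IsLieIdeal

variable {R : Type*} [NonUnitalRing R]

theorem addProd {K L : AddSubgroup R} (hK : IsLieIdeal K) (hL : IsLieIdeal L) :
    IsLieIdeal (addProd (K : Set R) (L : Set R)) := by
  intro x hx r
  induction hx using AddSubgroup.closure_induction with
  | mem x hx =>
    obtain ⟨k, hk, l, hl, rfl⟩ := hx
    have leibniz : k * l * r - r * (k * l) = k * (l * r - r * l) + (k * r - r * k) * l := by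
      noncomm_ring
    rw [leibniz]
    exact add_mem (mul_mem_addProd hk (hL l hl r)) (mul_mem_addProd (hK k hk r) hl)
  | zero => simp
  | add x y _ _ hx hy =>
    rw [add_mul, mul_add, add_sub_add_comm]
    exact add_mem hx hy
  | neg x _ hx =>
    rw [neg_mul, mul_neg, ← neg_sub_neg, neg_neg, neg_neg, ← neg_sub]
    exact neg_mem hx

variable [IsPrimeRing R]

theorem containsNonzeroIdeal_of_mul_left_mem {M : AddSubgroup R} (hM : IsLieIdeal M) {x : R}
    (hx : x ≠ 0) (h : ∀ r, r * x ∈ M) : ContainsNonzeroIdeal M := by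
  refine IsPrimeRing.containsNonzeroIdeal_of_mul_mul_mem hx fun r s => ?_
  have : r * x * s = (r * x * s - s * (r * x)) + s * r * x := by noncomm_ring
  rw [this]
  exact M.add_mem (hM _ (h r) s) (h (s * r))

theorem containsNonzeroIdeal_of_mul_right_mem {M : AddSubgroup R} (hM : IsLieIdeal M) {x : R}
    (hx : x ≠ 0) (h : ∀ r, x * r ∈ M) : ContainsNonzeroIdeal M := by
  refine IsPrimeRing.containsNonzeroIdeal_of_mul_mul_mem hx fun r s => ?_
  have : r * x * s = x * (s * r) - (x * s * r - r * (x * s)) := by noncomm_ring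
  rw [this]
  exact M.sub_mem (h (s * r)) (hM _ (h s) r)

variable {K L : AddSubgroup R}

theorem commutator_mul_comm (hK : IsLieIdeal K) (hL : IsLieIdeal L)
    (hKL : ¬ ContainsNonzeroIdeal (_root_.addProd (K : Set R) (L : Set R))) {k l l' : R}
    (hk : k ∈ K) (hl : l ∈ L) (hl' : l' ∈ L) :
    (k * l - l * k) * l' = (k * l' - l' * k) * l := by
  by_contra hne
  refine hKL ((hK.addProd hL).containsNonzeroIdeal_of_mul_left_mem (sub_ne_zero.2 hne) fun r => ?_)
  -- Expand `[k, rl]l' - [k, rl']l` by the Leibniz rule `[k, rl] = [k, r]l + r[k, l]`.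
  have key : r * ((k * l - l * k) * l' - (k * l' - l' * k) * l) =
      (k * (r * l) - r * l * k) * l' - (k * (r * l') - r * l' * k) * l -
        (k * r - r * k) * (l * l' - l' * l) := by
    noncomm_ring
  rw [key]
  exact sub_mem (sub_mem (mul_mem_addProd (hK k hk _) hl') (mul_mem_addProd (hK k hk _) hl))
    (mul_mem_addProd (hK k hk r) (hL l hl l'))

theorem mul_commutator_comm (hK : IsLieIdeal K) (hL : IsLieIdeal L)
    (hKL : ¬ ContainsNonzeroIdeal (_root_.addProd (K : Set R) (L : Set R))) {k k' l : R}
    (hk : k ∈ K) (hk' : k' ∈ K) (hl : l ∈ L) :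
    k * (l * k' - k' * l) = k' * (l * k - k * l) := by
  by_contra hne
  refine hKL ((hK.addProd hL).containsNonzeroIdeal_of_mul_right_mem (sub_ne_zero.2 hne) fun r => ?_)
  have key : (k * (l * k' - k' * l) - k' * (l * k - k * l)) * r =
      k * (l * (k' * r) - k' * r * l) - k' * (l * (k * r) - k * r * l) -
        (k * k' - k' * k) * (l * r - r * l) := by
    noncomm_ring
  rw [key]
  exact sub_mem (sub_mem (mul_mem_addProd hk (hL l hl _)) (mul_mem_addProd hk' (hL l hl _)))
    (mul_mem_addProd (hK k hk k') (hL l hl r))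

end IsLieIdeal

section LinearAlgebra

open Submodule

variable {F V : Type*} [Field F] [AddCommGroup V] [Module F V] {x y z : V}

theorem linearIndependent_triple (hy : y ∉ span F {z}) (hx : x ∉ span F {y, z}) (hz : z ≠ 0) :
    LinearIndependent F ![x, y, z] := by
  refine linearIndependent_finCons.2 ⟨linearIndependent_finCons.2 ⟨?_, ?_⟩, ?_⟩
  · exact LinearIndependent.of_subsingleton 0 hz
  · simpa using hy
  · simpa [Fin.range_cons, Set.pair_comm z y] using hx

theorem eq_zero_of_linearIndependent_triple (h : LinearIndependent F ![x, y, z]) {a b c : F}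
    (habc : a • x + b • y + c • z = 0) : a = 0 ∧ b = 0 ∧ c = 0 := by
  have := Fintype.linearIndependent_iff.1 h ![a, b, c] (by simpa [Fin.sum_univ_three] using habc)
  exact ⟨this 0, this 1, this 2⟩

theorem mem_span_pair_of_forall_dual
    (h : ∀ f : Module.Dual F V, f y = 0 → f z = 0 → f x = 0) : x ∈ span F {y, z} := by
  refine (Subspace.forall_mem_dualAnnihilator_apply_eq_zero_iff _ _).1 fun f hf => ?_
  rw [mem_dualAnnihilator] at hf
  exact h f (hf y (mem_span_of_mem (by simp))) (hf z (mem_span_of_mem (by simp)))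

theorem span_pair_eq_of_mem (hxz : x ∉ span F {z}) (hx : x ∈ span F {y, z}) :
    span F {x, z} = span F {y, z} := by
  have hz (w : V) : z ∈ span F {w, z} := mem_span_of_mem (by simp)
  refine le_antisymm (span_le.2 ?_) (span_le.2 ?_)
  · exact Set.pair_subset hx (hz y)
  · exact Set.pair_subset (mem_span_insert_exchange hx hxz) (hz x)

end LinearAlgebra

namespace Martindale

variable {R : Type*} [NonUnitalRing R] [IsPrimeRing R] [Nontrivial R]

local notation "C" => extendedCentroid R

namespace RightQuotient

open PartialHom

theorem mk_mul_ofRing (f : PartialHom R) {x : R} (hx : x ∈ f.dom) :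
    mk f * ofRing x = ofRing (f.toFun x) :=
  mk_eq_mk.2 (equiv_of_agree_dom fun y _ _ => f.map_mul' x hx y)

theorem eq_zero_of_mul_ofRing {p : RightQuotient R} {I : TwoSidedIdeal R} (hI : I ≠ ⊥)
    (h : ∀ x ∈ I, p * ofRing x = 0) : p = 0 := by
  induction p using ind with
  | h f =>
    refine mk_eq_mk.2 (equiv_of_agree hI fun x hx hxf _ => ofRing_injective ?_)
    rw [← mk_mul_ofRing f hxf, h x hx]
    exact (map_zero ofRing).symm

end RightQuotient

section SymmetricQuotient

open RightQuotient

theorem toQs_eq_zero {a : R} : toQs R a = 0 ↔ a = 0 :=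
  map_eq_zero_iff _ (toQs_injective R)

instance : Nontrivial (Qs R) := (toQs_injective R).nontrivial

theorem exists_forall_mem_toQs_mul_eq (q : Qs R) :
    ∃ J : TwoSidedIdeal R, J ≠ ⊥ ∧ ∀ x ∈ J, ∃ y, toQs R x * q = toQs R y :=
  let ⟨J, hJ, h⟩ := q.2
  ⟨J, hJ, fun x hx => (h x hx).imp fun _ hy => Subtype.ext hy⟩

theorem exists_forall_mem_mul_toQs_eq (q : Qs R) :
    ∃ J : TwoSidedIdeal R, J ≠ ⊥ ∧ ∀ x ∈ J, ∃ y, q * toQs R x = toQs R y := by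
  obtain ⟨p, hp⟩ := q
  induction p using RightQuotient.ind with
  | h f => exact ⟨f.dom, f.dom_ne_bot, fun x hx => ⟨f.toFun x, Subtype.ext (mk_mul_ofRing f hx)⟩⟩

theorem eq_zero_of_mul_toQs {p : Qs R} {I : TwoSidedIdeal R} (hI : I ≠ ⊥)
    (h : ∀ x ∈ I, p * toQs R x = 0) : p = 0 :=
  Subtype.ext (eq_zero_of_mul_ofRing hI fun x hx => congrArg Subtype.val (h x hx))

theorem exists_mul_toQs_eq {p : Qs R} (hp : p ≠ 0) : ∃ x y, y ≠ 0 ∧ p * toQs R x = toQs R y := by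
  obtain ⟨I, hI, hIp⟩ := exists_forall_mem_mul_toQs_eq p
  by_contra! h
  refine hp (eq_zero_of_mul_toQs hI fun x hx => ?_)
  obtain ⟨y, hy⟩ := hIp x hx
  by_contra hne
  exact h x y (fun hy0 => hne (by rw [hy, hy0, map_zero])) hy

theorem eq_zero_of_toQs_mul {p : Qs R} {I : TwoSidedIdeal R} (hI : I ≠ ⊥)
    (h : ∀ x ∈ I, toQs R x * p = 0) : p = 0 := by
  by_contra hp
  obtain ⟨z, y, hy, hzy⟩ := exists_mul_toQs_eq hp
  obtain ⟨x, hx, hx0⟩ := exists_ne_zero hI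
  obtain ⟨r, hr⟩ := IsPrimeRing.exists_mul_mul_ne_zero hx0 hy
  refine hr (toQs_eq_zero.1 ?_)
  rw [map_mul, ← hzy, ← mul_assoc, h _ (I.mul_mem_right _ _ hx), zero_mul]

theorem exists_toQs_mul_eq {p : Qs R} (hp : p ≠ 0) : ∃ x y, y ≠ 0 ∧ toQs R x * p = toQs R y := by
  obtain ⟨I, hI, hIp⟩ := exists_forall_mem_toQs_mul_eq p
  by_contra! h
  refine hp (eq_zero_of_toQs_mul hI fun x hx => ?_)
  obtain ⟨y, hy⟩ := hIp x hx
  by_contra hne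
  exact h x y (fun hy0 => hne (by rw [hy, hy0, map_zero])) hy

theorem eq_zero_or_eq_zero_of_mul_toQs_mul {p q : Qs R} {J : TwoSidedIdeal R} (hJ : J ≠ ⊥)
    (h : ∀ y ∈ J, p * toQs R y * q = 0) : p = 0 ∨ q = 0 := by
  by_contra! hpq
  obtain ⟨x, u, hu, hxu⟩ := exists_mul_toQs_eq hpq.1
  obtain ⟨y, v, hv, hyv⟩ := exists_toQs_mul_eq hpq.2
  obtain ⟨z, hz, huzv⟩ := IsPrimeRing.exists_mem_mul_mul_ne_zero hJ hu hv
  refine huzv (toQs_eq_zero.1 ?_)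
  calc toQs R (u * z * v) = p * toQs R (x * z * y) * q := by
        simp only [map_mul, ← hxu, ← hyv, mul_assoc]
    _ = 0 := h _ (J.mul_mem_right _ _ (J.mul_mem_left _ _ hz))

theorem mem_extendedCentroid_iff_commute_toQs {p : Qs R} :
    p ∈ C ↔ ∀ r, toQs R r * p = p * toQs R r := by
  refine ⟨fun hp r => Subring.mem_center_iff.1 hp _, fun h => Subring.mem_center_iff.2 fun q => ?_⟩
  obtain ⟨J, hJ, hJq⟩ := exists_forall_mem_toQs_mul_eq q
  refine sub_eq_zero.1 (eq_zero_of_toQs_mul hJ fun x hx => ?_)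
  obtain ⟨y, hy⟩ := hJq x hx
  rw [mul_sub, ← mul_assoc, ← mul_assoc, hy, h x, mul_assoc, hy, h y, sub_self]

theorem exists_extendedCentroid_smul_toQs_eq (f : PartialHom R)
    (hf : ∀ x ∈ f.dom, ∀ r, f.toFun (r * x) = r * f.toFun x) :
    ∃ c : C, ∀ x ∈ f.dom, c • toQs R x = toQs R (f.toFun x) := by
  have hcomm (r : R) : ofRing r * mk f = mk f * ofRing r := by
    refine sub_eq_zero.1 (eq_zero_of_mul_ofRing f.dom_ne_bot fun x hx => ?_)
    rw [sub_mul, mul_assoc, mul_assoc, mk_mul_ofRing f hx, ← map_mul, ← map_mul,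
      mk_mul_ofRing f (f.dom.mul_mem_left _ _ hx), hf x hx, sub_self]
  let c : Qs R := ⟨mk f, f.dom, f.dom_ne_bot, fun x hx =>
    ⟨f.toFun x, by rw [hcomm, mk_mul_ofRing f hx]⟩⟩
  have hc : c ∈ C := mem_extendedCentroid_iff_commute_toQs.2 fun r => Subtype.ext (hcomm r)
  exact ⟨⟨c, hc⟩, fun x hx => Subtype.ext (mk_mul_ofRing f hx)⟩

/-- `IsRatio a b J z t` says that `t r a = z r b` for all `r ∈ J`. If `b = c a` with `c` in the
extended centroid and `a ≠ 0`, this forces `t = c z`, so the relation describes multiplication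
by `c` on `R` without mentioning `c`. -/
def IsRatio (a b : Qs R) (J : TwoSidedIdeal R) (z t : R) : Prop :=
  ∀ r ∈ J, toQs R t * toQs R r * a = toQs R z * toQs R r * b

namespace IsRatio

variable {a b : Qs R} {J : TwoSidedIdeal R} {z z' t t' : R}

theorem zero : IsRatio a b J 0 0 := fun r _ => by
  simp only [map_zero, zero_mul]

theorem add (h : IsRatio a b J z t) (h' : IsRatio a b J z' t') :
    IsRatio a b J (z + z') (t + t') := fun r hr => by
  simp only [map_add, add_mul, h r hr, h' r hr]

theorem neg (h : IsRatio a b J z t) : IsRatio a b J (-z) (-t) := fun r hr => by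
  simp only [map_neg, neg_mul, h r hr]

theorem mul_left (h : IsRatio a b J z t) (s : R) : IsRatio a b J (s * z) (s * t) := fun r hr => by
  simpa only [map_mul, mul_assoc] using congrArg (toQs R s * ·) (h r hr)

theorem mul_right (h : IsRatio a b J z t) (s : R) : IsRatio a b J (z * s) (t * s) := fun r hr => by
  simpa only [map_mul, mul_assoc] using h (s * r) (J.mul_mem_left _ _ hr)

theorem unique (ha : a ≠ 0) (hJ : J ≠ ⊥) (h : IsRatio a b J z t) (h' : IsRatio a b J z t') :
    t = t' := by
  rw [← sub_eq_zero, ← toQs_eq_zero]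
  refine (eq_zero_or_eq_zero_of_mul_toQs_mul hJ fun r hr => ?_).resolve_right ha
  rw [map_sub, sub_mul, sub_mul, h r hr, h' r hr, sub_self]

end IsRatio

/-- The ideal of all `z : R` for which some `t : R` satisfies `IsRatio a b J z t`: the domain of
the partial homomorphism `ratioHom` on `R`. -/
def ratioIdeal (a b : Qs R) (J : TwoSidedIdeal R) : TwoSidedIdeal R :=
  TwoSidedIdeal.mk' {z | ∃ t, IsRatio a b J z t} ⟨0, .zero⟩
    (fun ⟨_, ht⟩ ⟨_, ht'⟩ => ⟨_, ht.add ht'⟩) (fun ⟨_, ht⟩ => ⟨_, ht.neg⟩)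
    (fun ⟨_, ht⟩ => ⟨_, ht.mul_left _⟩) (fun ⟨_, ht⟩ => ⟨_, ht.mul_right _⟩)

theorem mem_ratioIdeal {a b : Qs R} {J : TwoSidedIdeal R} {z : R} :
    z ∈ ratioIdeal a b J ↔ ∃ t, IsRatio a b J z t :=
  TwoSidedIdeal.mem_mk' _ _ _ _ _ _ z

theorem ratioIdeal_ne_bot {a b : Qs R} (ha : a ≠ 0) {J : TwoSidedIdeal R}
    (h : ∀ y ∈ J, a * toQs R y * b = b * toQs R y * a) : ratioIdeal a b J ≠ ⊥ := by
  obtain ⟨I, hI, hIa⟩ := exists_forall_mem_toQs_mul_eq a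
  obtain ⟨I', hI', hIb⟩ := exists_forall_mem_toQs_mul_eq b
  intro hbot
  refine ha (eq_zero_of_toQs_mul (inf_ne_bot hI hI') fun x hx => ?_)
  rw [TwoSidedIdeal.mem_inf] at hx
  obtain ⟨z, hz⟩ := hIa x hx.1
  obtain ⟨t, ht⟩ := hIb x hx.2
  have hzt : IsRatio a b J z t := fun r hr => by
    simpa only [← hz, ← ht, mul_assoc] using congrArg (toQs R x * ·) (h r hr).symm
  rw [hz, toQs_eq_zero, ← TwoSidedIdeal.mem_bot R, ← hbot]
  exact mem_ratioIdeal.2 ⟨t, hzt⟩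

/-- The partial homomorphism sending `z` to the unique `t` with `IsRatio a b J z t`: the
candidate for multiplication by the ratio of `b` to `a`. -/
noncomputable def ratioHom {a b : Qs R} (ha : a ≠ 0) {J : TwoSidedIdeal R} (hJ : J ≠ ⊥)
    (h : ∀ y ∈ J, a * toQs R y * b = b * toQs R y * a) : PartialHom R where
  dom := ratioIdeal a b J
  dom_ne_bot := ratioIdeal_ne_bot ha h
  toFun z := Classical.epsilon (IsRatio a b J z)
  map_add' x hx y hy := by
    have hx := Classical.epsilon_spec (mem_ratioIdeal.1 hx)
    have hy := Classical.epsilon_spec (mem_ratioIdeal.1 hy)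
    exact (Classical.epsilon_spec ⟨_, hx.add hy⟩ : IsRatio ..).unique ha hJ (hx.add hy)
  map_mul' x hx s := by
    have hx := Classical.epsilon_spec (mem_ratioIdeal.1 hx)
    exact (Classical.epsilon_spec ⟨_, hx.mul_right s⟩ : IsRatio ..).unique ha hJ (hx.mul_right s)

section ratioHom

variable {a b : Qs R} (ha : a ≠ 0) {J : TwoSidedIdeal R} (hJ : J ≠ ⊥)
  (h : ∀ y ∈ J, a * toQs R y * b = b * toQs R y * a) {z : R}

theorem isRatio_ratioHom (hz : z ∈ (ratioHom ha hJ h).dom) :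
    IsRatio a b J z ((ratioHom ha hJ h).toFun z) :=
  Classical.epsilon_spec (mem_ratioIdeal.1 hz)

theorem ratioHom_mul_left (hz : z ∈ (ratioHom ha hJ h).dom) (s : R) :
    (ratioHom ha hJ h).toFun (s * z) = s * (ratioHom ha hJ h).toFun z :=
  (isRatio_ratioHom ha hJ h (TwoSidedIdeal.mul_mem_left _ _ _ hz)).unique ha hJ
    ((isRatio_ratioHom ha hJ h hz).mul_left s)

end ratioHom

theorem exists_eq_smul_of_mul_toQs_mul_comm {a b : Qs R} (ha : a ≠ 0) {J : TwoSidedIdeal R}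
    (hJ : J ≠ ⊥) (h : ∀ y ∈ J, a * toQs R y * b = b * toQs R y * a) : ∃ c : C, b = c • a := by
  obtain ⟨c, hc⟩ := exists_extendedCentroid_smul_toQs_eq (ratioHom ha hJ h)
    fun z hz s => ratioHom_mul_left ha hJ h hz s
  obtain ⟨z, hz, hz0⟩ := exists_ne_zero (ratioHom ha hJ h).dom_ne_bot
  refine ⟨c, sub_eq_zero.1 <| (eq_zero_or_eq_zero_of_mul_toQs_mul hJ (p := toQs R z)
    fun r hr => ?_).resolve_left (toQs_eq_zero.not.2 hz0)⟩
  have hcentral (q : Qs R) : q * c = c * q := Subring.mem_center_iff.1 c.2 q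
  rw [mul_sub, sub_eq_zero, ← isRatio_ratioHom ha hJ h hz r hr, ← hc z hz, Subring.smul_def,
    Subring.smul_def, smul_eq_mul, smul_eq_mul, ← mul_assoc _ (c : Qs R), hcentral,
    mul_assoc (c : Qs R)]

end SymmetricQuotient

section ExtendedCentroid

open Submodule

instance : CommRing C := inferInstanceAs (CommRing (Subring.center (Qs R)))

instance : Algebra C (Qs R) := inferInstanceAs (Algebra (Subring.center (Qs R)) (Qs R))

theorem isUnit_or_eq_zero (c : C) : IsUnit c ∨ c = 0 := by
  refine or_iff_not_imp_right.2 fun hc => ?_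
  obtain ⟨d, hd⟩ := exists_eq_smul_of_mul_toQs_mul_comm (a := (c : Qs R)) (b := 1)
    (Subtype.coe_ne_coe.2 hc) top_ne_bot fun y _ => by
      rw [mul_one, one_mul, mem_extendedCentroid_iff_commute_toQs.1 c.2]
  exact IsUnit.of_mul_eq_one_right d (Subtype.ext hd.symm)

noncomputable instance : Field C := Field.ofIsUnitOrEqZero isUnit_or_eq_zero

theorem centroidSpan_eq (A : Set R) :
    centroidSpan A = (span C (toQs R '' A)).toAddSubgroup := by
  refine le_antisymm (addProd_le.2 fun a ha c hc => ?_) fun x hx => ?_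
  · rw [Subring.mem_center_iff.1 hc a]
    exact smul_mem _ (⟨c, hc⟩ : C) (subset_span ha)
  · induction hx using closure_induction with
    | zero => exact zero_mem _
    | add x y _ _ hx hy => exact add_mem hx hy
    | smul_mem c a ha =>
      rw [Subring.smul_def, smul_eq_mul, ← Subring.mem_center_iff.1 c.2 a]
      exact mul_mem_addProd ha c.2

theorem centroidLine_eq (a : R) : centroidLine a = (span C {toQs R a, 1}).toAddSubgroup := by
  refine le_antisymm (sup_le (addProd_le.2 ?_) fun c hc => ?_) fun x hx => ?_
  · rintro c hc _ rfl
    exact smul_mem _ (⟨c, hc⟩ : C) (mem_span_of_mem (by simp))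
  · rw [← mul_one c]
    exact smul_mem _ (⟨c, hc⟩ : C) (mem_span_of_mem (by simp))
  · obtain ⟨c, d, rfl⟩ := mem_span_pair.1 ((mem_toAddSubgroup _).1 hx)
    refine AddSubgroup.add_mem_sup (mul_mem_addProd c.2 rfl) ?_
    rw [Subring.smul_def, smul_eq_mul, mul_one]
    exact d.2

end ExtendedCentroid

section LinearIdentities

open TensorProduct

theorem eq_zero_of_sum_mul_toQs_mul_eq_zero {ι : Type*} {e : ι → Qs R}
    (he : LinearIndependent C e) (s : Finset ι) (b : ι → Qs R)
    (h : ∀ x, ∑ i ∈ s, b i * toQs R x * e i = 0) : ∀ i ∈ s, b i = 0 := by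
  induction s using Finset.cons_induction generalizing b with
  | empty => exact fun i hi => absurd hi (Finset.notMem_empty i)
  | cons j s hj ih =>
    simp only [Finset.sum_cons] at h
    suffices hbj : b j = 0 from (Finset.forall_mem_cons hj _).2
      ⟨hbj, ih b fun x => by simpa only [hbj, zero_mul, zero_add] using h x⟩
    by_contra hbj
    obtain ⟨J, hJ, hJb⟩ := exists_forall_mem_toQs_mul_eq (b j)
    have hcross : ∀ i ∈ s, ∀ y ∈ J, b j * toQs R y * b i = b i * toQs R y * b j := by
      intro i hi y hy
      obtain ⟨z, hz⟩ := hJb y hy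
      refine sub_eq_zero.1 (ih (fun i => b j * toQs R y * b i - b i * toQs R y * b j)
        (fun x => ?_) i hi)
      -- The `e j` term cancels in this combination of the identities at `x` and at `z * x`.
      calc ∑ i ∈ s, (b j * toQs R y * b i - b i * toQs R y * b j) * toQs R x * e i
          = b j * toQs R y * (b j * toQs R x * e j + ∑ i ∈ s, b i * toQs R x * e i) -
              (b j * toQs R (z * x) * e j + ∑ i ∈ s, b i * toQs R (z * x) * e i) := by
            simp only [map_mul, ← hz, sub_mul, Finset.sum_sub_distrib, mul_add, Finset.mul_sum,
              mul_assoc, add_sub_add_left_eq_sub]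
        _ = 0 := by rw [h, h, mul_zero, sub_zero]
    have hprop : ∀ i ∈ s, ∃ c : C, b i = c • b j := fun i hi =>
      exists_eq_smul_of_mul_toQs_mul_comm hbj hJ (hcross i hi)
    choose! c hc using hprop
    have hdep : e j + ∑ i ∈ s, c i • e i = 0 := by
      refine (eq_zero_or_eq_zero_of_mul_toQs_mul top_ne_bot fun x _ => ?_).resolve_left hbj
      rw [mul_add, Finset.mul_sum, ← h x]
      congr 1
      refine Finset.sum_congr rfl fun i hi => ?_
      rw [hc i hi, mul_smul_comm, smul_mul_assoc, smul_mul_assoc]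
    refine he.notMem_span_image (Finset.mem_coe.not.2 hj) ?_
    rw [eq_neg_of_add_eq_zero_left hdep]
    exact neg_mem (sum_mem fun i hi =>
      Submodule.smul_mem _ _ (Submodule.subset_span (Set.mem_image_of_mem e hi)))

/-- The map sending `∑ aᵢ ⊗ bᵢ` to the linear generalized polynomial function `x ↦ ∑ aᵢ x bᵢ`
on `R`. -/
noncomputable def sandwich : Qs R ⊗[C] Qs R →ₗ[C] R → Qs R :=
  TensorProduct.lift <| LinearMap.mk₂ C (fun a b x => a * toQs R x * b)
    (fun _ _ _ => funext fun _ => by simp only [Pi.add_apply, add_mul])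
    (fun _ _ _ => funext fun _ => by simp only [Pi.smul_apply, smul_mul_assoc])
    (fun _ _ _ => funext fun _ => by simp only [Pi.add_apply, mul_add])
    (fun _ _ _ => funext fun _ => by simp only [Pi.smul_apply, mul_smul_comm])

theorem sandwich_tmul (a b : Qs R) (x : R) : sandwich (a ⊗ₜ[C] b) x = a * toQs R x * b :=
  rfl

theorem sandwich_injective : Function.Injective (sandwich (R := R)) := by
  refine (injective_iff_map_eq_zero _).2 fun t ht => ?_
  let e := Module.Basis.ofVectorSpace C (Qs R)
  obtain ⟨b, rfl⟩ := TensorProduct.eq_repr_basis_right e t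
  refine Finset.sum_eq_zero fun i hi => ?_
  have hbi : b i = 0 :=
    eq_zero_of_sum_mul_toQs_mul_eq_zero e.linearIndependent b.support b (fun x => ?_) i hi
  · simp only [hbi, TensorProduct.zero_tmul]
  simpa only [Finsupp.sum, map_sum, Finset.sum_apply, sandwich_tmul, Pi.zero_apply]
    using congrFun ht x

end LinearIdentities

open Submodule

section CommutatorIdentities

open TensorProduct

variable {p q : Qs R}

theorem tensor_eq_zero_of_lie_mul_lie (h : ∀ x, ⁅p, q⁆ * ⁅q, toQs R x⁆ = ⁅p, ⁅q, toQs R x⁆⁆ * q) :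
    (⁅p, q⁆ * q) ⊗ₜ[C] 1 - (⁅p, q⁆ + p * q) ⊗ₜ q + p ⊗ₜ (q * q) + q ⊗ₜ (p * q) -
      1 ⊗ₜ (q * p * q) = (0 : Qs R ⊗[C] Qs R) := by
  refine sandwich_injective (funext fun x => ?_)
  simp only [map_add, map_sub, Pi.add_apply, Pi.sub_apply, sandwich_tmul, map_zero, Pi.zero_apply,
    ← sub_eq_zero.2 (h x), Ring.lie_def]
  noncomm_ring

theorem tensor_eq_zero_of_mul_lie_lie
    (h : ∀ x, p * ⁅q, ⁅p, toQs R x⁆⁆ = ⁅p, toQs R x⁆ * ⁅q, p⁆) :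
    (p * q * p) ⊗ₜ[C] 1 - (p * q) ⊗ₜ p - (p * p) ⊗ₜ q + p ⊗ₜ (p * q - ⁅q, p⁆) +
      1 ⊗ₜ (p * ⁅q, p⁆) = (0 : Qs R ⊗[C] Qs R) := by
  refine sandwich_injective (funext fun x => ?_)
  simp only [map_add, map_sub, Pi.add_apply, Pi.sub_apply, sandwich_tmul, map_zero, Pi.zero_apply,
    ← sub_eq_zero.2 (h x), Ring.lie_def]
  noncomm_ring

theorem mul_self_mem_and_mul_mem_span_pair (hpq : LinearIndependent C ![p, q, 1])
    (h : ∀ x, ⁅p, q⁆ * ⁅q, toQs R x⁆ = ⁅p, ⁅q, toQs R x⁆⁆ * q) :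
    q * q ∈ span C {q, 1} ∧ p * q ∈ span C {q, 1} := by
  have hf (f : Module.Dual C (Qs R)) (hfq : f q = 0) (hf1 : f 1 = 0) :
      f (q * q) = 0 ∧ f (p * q) = 0 := by
    have hcontract : f (q * q) • p + f (p * q) • q + -f (q * p * q) • (1 : Qs R) = 0 := by
      simpa [hfq, hf1, ← sub_eq_add_neg] using
        congrArg (TensorProduct.rid C (Qs R) ∘ f.lTensor (Qs R)) (tensor_eq_zero_of_lie_mul_lie h)
    obtain ⟨hqq, hpq, -⟩ := eq_zero_of_linearIndependent_triple hpq hcontract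
    exact ⟨hqq, hpq⟩
  exact ⟨mem_span_pair_of_forall_dual fun f hfq hf1 => (hf f hfq hf1).1,
    mem_span_pair_of_forall_dual fun f hfq hf1 => (hf f hfq hf1).2⟩

theorem mul_mem_span_pair (hpq : LinearIndependent C ![p, q, 1])
    (h : ∀ x, p * ⁅q, ⁅p, toQs R x⁆⁆ = ⁅p, toQs R x⁆ * ⁅q, p⁆) : p * q ∈ span C {p, 1} := by
  refine mem_span_pair_of_forall_dual fun f hfp hf1 => ?_
  have hcontract : -f (p * q) • p + -f (p * p) • q + f (p * q * p) • (1 : Qs R) = 0 := by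
    have := congrArg (TensorProduct.lid C (Qs R) ∘ f.rTensor (Qs R))
      (tensor_eq_zero_of_mul_lie_lie h)
    simp only [Function.comp_apply, map_add, map_sub, LinearMap.rTensor_tmul, hfp, zero_tmul,
      add_zero, hf1, lid_tmul, map_zero] at this
    rw [← this]
    module
  exact neg_eq_zero.1 (eq_zero_of_linearIndependent_triple hpq hcontract).1

theorem mul_eq_zero_of_linearIndependent (hpq : LinearIndependent C ![p, q, 1])
    (hright : ∀ x, ⁅p, q⁆ * ⁅q, toQs R x⁆ = ⁅p, ⁅q, toQs R x⁆⁆ * q)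
    (hleft : ∀ x, p * ⁅q, ⁅p, toQs R x⁆⁆ = ⁅p, toQs R x⁆ * ⁅q, p⁆) : p * q = 0 := by
  obtain ⟨hqq, hpq_right⟩ := mul_self_mem_and_mul_mem_span_pair hpq hright
  obtain ⟨t, s, hqq⟩ := mem_span_pair.1 hqq
  obtain ⟨β, α, hβα⟩ := mem_span_pair.1 hpq_right
  obtain ⟨β', α', hβα'⟩ := mem_span_pair.1 (mul_mem_span_pair hpq hleft)
  obtain ⟨-, rfl, -⟩ := eq_zero_of_linearIndependent_triple hpq
    (a := -β') (b := β) (c := α - α') <|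
    calc -β' • p + β • q + (α - α') • (1 : Qs R)
        = (β • q + α • 1) - (β' • p + α' • 1) := by module
      _ = 0 := by rw [hβα, hβα', sub_self]
  have hα : p * q = α • 1 := by rw [← hβα, zero_smul, zero_add]
  obtain ⟨-, rfl, -⟩ := eq_zero_of_linearIndependent_triple hpq
    (a := -s) (b := α) (c := -(t * α)) <|
    calc -s • p + α • q + -(t * α) • (1 : Qs R)
        = α • q - (t • α • 1 + s • p) := by module
      _ = p * q * q - p * (q * q) := by
        rw [← hqq, hα, mul_add, mul_smul_comm, mul_smul_comm, hα, mul_one, smul_one_mul]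
      _ = 0 := by rw [mul_assoc, sub_self]
  rw [hα, zero_smul]

end CommutatorIdentities

section LieIdeals

variable {K L : AddSubgroup R}

theorem mem_center_iff_mem_span_one {a : R} : a ∈ Set.center R ↔ toQs R a ∈ span C {1} := by
  rw [Semigroup.mem_center_iff, mem_span_singleton]
  constructor
  · intro h
    have hC : toQs R a ∈ C := mem_extendedCentroid_iff_commute_toQs.2 fun r => by
      rw [← map_mul, h r, map_mul]
    exact ⟨⟨toQs R a, hC⟩, mul_one _⟩
  · rintro ⟨c, hc⟩ r
    refine toQs_injective R ?_
    rw [map_mul, map_mul, ← hc, mul_smul_comm, smul_mul_assoc, one_mul, mul_one]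

theorem mul_eq_zero_of_notMem_span_pair (hK : IsLieIdeal K) (hL : IsLieIdeal L)
    (hKL : ¬ ContainsNonzeroIdeal (addProd (K : Set R) (L : Set R))) {k l : R} (hk : k ∈ K)
    (hl : l ∈ L) (hlc : l ∉ Set.center R) (hkl : toQs R k ∉ span C {toQs R l, 1}) : k * l = 0 := by
  rw [mem_center_iff_mem_span_one] at hlc
  rw [← toQs_eq_zero, map_mul]
  refine mul_eq_zero_of_linearIndependent (linearIndependent_triple hlc hkl one_ne_zero)
    (fun x => ?_) (fun x => ?_)
  · simpa only [Ring.lie_def, map_mul, map_sub] using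
      congrArg (toQs R) (hK.commutator_mul_comm hL hKL hk hl (hL l hl x))
  · simpa only [Ring.lie_def, map_mul, map_sub] using
      congrArg (toQs R) (hK.mul_commutator_comm hL hKL hk (hK k hk x) hl)

theorem mem_span_pair_of_not_containsNonzeroIdeal (hK : IsLieIdeal K) (hL : IsLieIdeal L)
    (hKL : ¬ ContainsNonzeroIdeal (addProd (K : Set R) (L : Set R))) {k l : R} (hk : k ∈ K)
    (hl : l ∈ L) (hlc : l ∉ Set.center R) : toQs R k ∈ span C {toQs R l, 1} := by
  by_contra hkl
  have hmul {k' : R} (hk' : k' ∈ K) (h : toQs R k' ∉ span C {toQs R l, 1}) : k' * l = 0 :=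
    mul_eq_zero_of_notMem_span_pair hK hL hKL hk' hl hlc h
  have hKl : ∀ k' ∈ K, k' * l = 0 := fun k' hk' => by
    by_cases h : toQs R k' ∈ span C {toQs R l, 1}
    · have hadd : (k + k') * l = 0 := hmul (K.add_mem hk hk') <| by
        rwa [map_add, Submodule.add_mem_iff_left _ h]
      rwa [add_mul, hmul hk hkl, zero_add] at hadd
    · exact hmul hk' h
  have hkRl : ∀ r, k * r * l = 0 := fun r => by
    have hcomm := hKl _ (hK k hk r)
    rwa [sub_mul, mul_assoc r, hKl k hk, mul_zero, sub_zero] at hcomm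
  rcases IsPrimeRing.eq_zero_or_eq_zero k l hkRl with rfl | rfl
  · exact hkl (by rw [map_zero]; exact zero_mem _)
  · exact hlc Set.zero_mem_center

theorem exists_commutator_notMem_span {a : R} (ha : a ∉ Set.center R) :
    ∃ r, toQs R (a * r - r * a) ∉ span C {toQs R a} := by
  by_contra! h
  simp only [mem_span_singleton] at h
  choose δ hδ using h
  obtain ⟨r, hr⟩ := exists_commutator_ne_zero ha
  have hδr : δ r ≠ 0 := fun h0 => hr (by rw [← toQs_eq_zero, ← hδ, h0, zero_smul])
  have hsq : δ r • (toQs R a * toQs R a) = δ (a * r) • toQs R a := by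
    rw [← mul_smul_comm, hδ, hδ, ← map_mul, mul_sub, mul_assoc]
  obtain ⟨γ, hγ⟩ : ∃ γ : C, toQs R a * toQs R a = γ • toQs R a :=
    ⟨(δ r)⁻¹ * δ (a * r), by rw [mul_smul, ← hsq, inv_smul_smul₀ hδr]⟩
  -- Both `a[a, s]` and `γ[a, s]` equal `δ(s)a²`.
  have hprod (s : R) : (toQs R a - γ • 1) * toQs R s * toQs R a = 0 := by
    have hcomm : toQs R a * toQs R (a * s - s * a) = γ • toQs R (a * s - s * a) := by
      rw [← hδ, mul_smul_comm, hγ, smul_comm]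
    rw [map_sub, map_mul, map_mul, mul_sub, ← mul_assoc, ← mul_assoc, hγ, smul_sub,
      smul_mul_assoc, sub_right_inj] at hcomm
    rw [sub_mul, sub_mul, hcomm, smul_one_mul, smul_mul_assoc, sub_self]
  rcases eq_zero_or_eq_zero_of_mul_toQs_mul top_ne_bot fun s _ => hprod s with h | h
  · exact ha (mem_center_iff_mem_span_one.2 (mem_span_singleton.2 ⟨γ, (sub_eq_zero.1 h).symm⟩))
  · exact ha (toQs_eq_zero.1 h ▸ Set.zero_mem_center)

theorem span_image_eq_span_pair {M : AddSubgroup R} (hM : IsLieIdeal M) {m : R} (hm : m ∈ M)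
    (hmc : m ∉ Set.center R) (h : ∀ x ∈ M, toQs R x ∈ span C {toQs R m, 1}) :
    span C (toQs R '' M) = span C {toQs R m, 1} := by
  have hmM : toQs R m ∈ span C (toQs R '' M) := subset_span ⟨m, hm, rfl⟩
  obtain ⟨r, hr⟩ := exists_commutator_notMem_span hmc
  have hone : 1 ∈ span C {toQs R (m * r - r * m), toQs R m} :=
    mem_span_insert_exchange (Set.pair_comm (toQs R m) 1 ▸ h _ (hM m hm r)) hr
  refine le_antisymm (span_le.2 (Set.image_subset_iff.2 h)) (span_le.2 ?_)
  exact Set.pair_subset hmM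
    (span_le.2 (Set.pair_subset (subset_span (Set.mem_image_of_mem _ (hM m hm r))) hmM) hone)

theorem exists_span_eq_of_not_containsNonzeroIdeal (hK : IsLieIdeal K) (hL : IsLieIdeal L)
    (hKc : ¬ (K : Set R) ⊆ Set.center R) (hLc : ¬ (L : Set R) ⊆ Set.center R)
    (hKL : ¬ ContainsNonzeroIdeal (addProd (K : Set R) (L : Set R))) :
    ∃ a ∈ L, span C (toQs R '' K) = span C (toQs R '' L) ∧
      span C (toQs R '' L) = span C {toQs R a, 1} := by
  obtain ⟨k, hk, hkc⟩ := Set.not_subset.1 hKc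
  obtain ⟨l, hl, hlc⟩ := Set.not_subset.1 hLc
  have hmem {k l : R} (hk : k ∈ K) (hl : l ∈ L) (hlc : l ∉ Set.center R) :
      toQs R k ∈ span C {toQs R l, 1} :=
    mem_span_pair_of_not_containsNonzeroIdeal hK hL hKL hk hl hlc
  rw [mem_center_iff_mem_span_one] at hkc
  have hpair {l : R} (hl : l ∈ L) (hlc : l ∉ Set.center R) :
      span C {toQs R k, 1} = span C {toQs R l, 1} := span_pair_eq_of_mem hkc (hmem hk hl hlc)
  have hLk : ∀ x ∈ L, toQs R x ∈ span C {toQs R k, 1} := fun x hx => by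
    by_cases hxc : x ∈ Set.center R
    · exact span_mono (by simp) (mem_center_iff_mem_span_one.1 hxc)
    · exact hpair hx hxc ▸ mem_span_of_mem (by simp)
  have hKspan : span C (toQs R '' K) = span C {toQs R l, 1} :=
    (span_image_eq_span_pair hK hk (mem_center_iff_mem_span_one.not.2 hkc)
      fun x hx => hpair hl hlc ▸ hmem hx hl hlc).trans (hpair hl hlc)
  have hLspan : span C (toQs R '' L) = span C {toQs R l, 1} :=
    span_image_eq_span_pair hL hl hlc fun x hx => hpair hl hlc ▸ hLk x hx
  exact ⟨l, hl, hKspan.trans hLspan.symm, hLspan⟩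

theorem commute_of_mem_span_pair_one {a x : R} (h : toQs R x ∈ span C {toQs R a, 1}) :
    x * a = a * x := by
  obtain ⟨c, d, hx⟩ := mem_span_pair.1 h
  refine toQs_injective R ?_
  simp only [map_mul, ← hx, add_mul, mul_add, smul_mul_assoc, mul_smul_comm, one_mul, mul_one]

theorem not_containsNonzeroIdeal_of_span_eq {a : R} (hLc : ¬ (L : Set R) ⊆ Set.center R)
    (hKL : span C (toQs R '' K) = span C (toQs R '' L))
    (hLa : span C (toQs R '' L) = span C {toQs R a, 1}) :
    ¬ ContainsNonzeroIdeal (addProd (K : Set R) (L : Set R)) := by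
  rintro ⟨I, hI, hIKL⟩
  have hL (l) (hl : l ∈ L) : toQs R l ∈ span C {toQs R a, 1} :=
    hLa ▸ mem_span_of_mem (Set.mem_image_of_mem _ hl)
  have hK (k) (hk : k ∈ K) : toQs R k ∈ span C {toQs R a, 1} :=
    hLa ▸ hKL ▸ mem_span_of_mem (Set.mem_image_of_mem _ hk)
  have hcentralizer := addProd_le_centralizer (s := a)
    (fun k hk => commute_of_mem_span_pair_one (hK k hk))
    (fun l hl => commute_of_mem_span_pair_one (hL l hl))
  have ha : a ∈ Set.center R := IsPrimeRing.mem_center_of_commute_ideal hI fun x hx =>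
    (NonUnitalSubring.mem_centralizer_iff.1 (hcentralizer (hIKL hx)) a rfl).symm
  rw [mem_center_iff_mem_span_one] at ha
  refine hLc fun l hl => mem_center_iff_mem_span_one.2 ?_
  rw [← span_insert_eq_span ha]
  exact hL l hl

end LieIdeals

end Martindale

open Martindale Submodule in
theorem mainTheorem12 {R : Type*} [NonUnitalRing R] [IsPrimeRing R] [Nontrivial R]
    (K L : AddSubgroup R) (hK : IsLieIdeal K) (hL : IsLieIdeal L)
    (hKc : ¬ (K : Set R) ⊆ Set.center R) (hLc : ¬ (L : Set R) ⊆ Set.center R) :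
    ContainsNonzeroIdeal (addProd (K : Set R) (L : Set R)) ↔
      ¬ ∃ a ∈ L, Martindale.centroidSpan (K : Set R) = Martindale.centroidSpan (L : Set R) ∧
        Martindale.centroidSpan (L : Set R) = Martindale.centroidLine a := by
  simp only [centroidSpan_eq, centroidLine_eq, toAddSubgroup_inj]
  constructor
  · rintro hKL ⟨a, -, hspan, hLa⟩
    exact not_containsNonzeroIdeal_of_span_eq hLc hspan hLa hKL
  · contrapose!
    exact exists_span_eq_of_not_containsNonzeroIdeal hK hL hKc hLc
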